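/- Let $U$ be a finite set, let $\mathcal M$ be a matroid on $U$, and let $\mathcal P_{\mathcal M}\subseteq[0,1]^U$ be its matroid polytope, i.e. the convex hull of the indicator vectors of the independent sets of $\mathcal M$. Let $\mathcal D$ be a probability distribution over $2^U$ with marginals $x_i=\Pr_{S\sim\mathcal D}[i\in S]$, $i\in U$. Suppose that $\mathcal D$ satisfies Weak Negative Regression (WNR): for every $i\in U$ with $0<x_i<1$ and every monotone function $f:2^U\to\mathbb R$ (that is, $f(S)\le f(T)$ whenever $S\subseteq T$), $$\mathbb E_{S\sim\mathcal D}\bigl[f(S\setminus\{i\})\mid i\in S\bigr]\;\le\;\mathbb E_{S\sim\mathcal D}\bigl[f(S\setminus\{i\})\mid i\notin S\bigr].$$ If $\mathbf x=(x_i)_{i\in U}\in\mathcal P_{\mathcal M}$, then there exists a $(1-1/e)$-selectable contention resolution scheme for $\mathcal M$ and $\mathcal D$: a (possibly randomized) mapping $\pi$ that sends every $S\subseteq U$ to an independent set $\pi(S)$ of $\mathcal M$ with $\pi(S)\subseteq S$, such that $$\Pr_{S\sim\mathcal D}\bigl[i\in\pi(S)\bigr]\;\ge\;\Bigl(1-\frac1e\Bigr)\,x_i\qquad\text{for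 all } i\in U,$$ where the probability is over both $S\sim\mathcal D$ and the randomness of $\pi$. -/

import Mathlib

/-- The probability that a random set `S ∼ D` satisfies `p`. -/
noncomputable def setProb {U : Type*} [Fintype U] [DecidableEq U]
    (D : PMF (Finset U)) (p : Finset U → Prop) [DecidablePred p] : ℝ :=
  ∑ S with p S, (D S).toReal

/-- The vector of marginals of `D`: the `i`-th entry is the probability that `i ∈ S` for `S ∼ D`. -/
noncomputable def marginals {U : Type*} [Fintype U] [DecidableEq U]
    (D : PMF (Finset U)) (i : U) : ℝ :=
  setProb D (fun S => i ∈ S)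

/-- The conditional expectation of `g S` for `S ∼ D` given the event `p S`
(meaningful only if that event has positive probability). -/
noncomputable def condExpectation {U : Type*} [Fintype U] [DecidableEq U]
    (D : PMF (Finset U)) (p : Finset U → Prop) [DecidablePred p] (g : Finset U → ℝ) : ℝ :=
  (∑ S with p S, (D S).toReal * g S) / setProb D p

/-- Weak Negative Regression: `E[f (S \ i) | i ∈ S] ≤ E[f (S \ i) | i ∉ S]` for every element `i`
and every monotone `f`. The inequality is required exactly for those `i` for which both
conditional expectations are defined, i.e. both events have positive probability. -/
def IsWNR {U : Type*} [Fintype U] [DecidableEq U] (D : PMF (Finset U)) : Prop :=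
  ∀ i : U, 0 < setProb D (fun S => i ∈ S) → 0 < setProb D (fun S => i ∉ S) →
    ∀ f : Finset U → ℝ, Monotone f →
      condExpectation D (fun S => i ∈ S) (fun S => f (S \ {i})) ≤
        condExpectation D (fun S => i ∉ S) (fun S => f (S \ {i}))

/-- The matroid polytope: the convex hull of the indicator vectors of the independent sets.
It contains the convex hull of the indicator vectors of the bases (maximal independent sets). -/
def matroidPolytope {U : Type*} (M : Matroid U) : Set (U → ℝ) :=
  convexHull ℝ {v | ∃ I : Set U, M.Indep I ∧ v = I.indicator 1}

/-- A contention resolution scheme: a randomized map (each `S` is sent to a distribution on sets)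
whose value at `S` is, with probability one, an independent subset of `S`. -/
def IsContentionResolutionScheme {U : Type*} (M : Matroid U)
    (π : Finset U → PMF (Finset U)) : Prop :=
  ∀ S, ∀ T ∈ (π S).support, T ⊆ S ∧ M.Indep (T : Set U)

/-- `π` is `c`-selectable for `D`: for `S ∼ D`, every `i` belongs to the random set `π S` with
probability at least `c` times its marginal. Here `D.bind π` is the law of `π S` for `S ∼ D`. -/
def IsSelectable {U : Type*} [Fintype U] [DecidableEq U] (c : ℝ) (D : PMF (Finset U))
    (π : Finset U → PMF (Finset U)) : Prop :=
  ∀ i : U, c * marginals D i ≤ setProb (D.bind π) (fun T => i ∈ T)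

/-!
A linear functional `w` attains over the polytope of the independent subsets of `S` the maximum
`r_w(S)`, the weighted rank. Separation of a point from a compact convex set therefore reduces the
theorem to the bound `(1 - 1/e) * ∑ i, w i * x i ≤ E[r_w(S)]` for all `w`. Write `x` as the
marginals of a random independent set `I`, so that `∑ i, w i * x i = E[w(I)] ≤ E[r_w(I)]`.

It remains to bound the correlation gap of the monotone submodular function `f = r_w`. Let `R_t`
keep each element of `S` independently with probability `t`, and put `φ(t) = E[f(R_t)]`. By Russo's
formula `φ'(t)` is the expected sum over `i ∈ S` of the gain of adding `i` to `R_t \ {i}`. That gain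
is antitone in `S \ {i}`, so weak negative regression decouples it from the event `i ∈ S` and bounds
`φ'(t)` below by the sum of `x i` times the expected gain of `i`, which by submodularity is at
least `E[f(I)] - φ(t)`. Integrating this differential inequality gives
`φ(1) ≥ (1 - 1/e) * E[f(I)]`.
-/

section Expectation

variable {α : Type*} [Fintype α]

/-- The expectation of a real function of `a ∼ D`, as a linear functional of that function. -/
noncomputable def expectation (D : PMF α) : (α → ℝ) →ₗ[ℝ] ℝ :=
  ∑ a, (D a).toReal • LinearMap.proj a

theorem expectation_apply (D : PMF α) (g : α → ℝ) :
    expectation D g = ∑ a, (D a).toReal * g a := by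
  simp [expectation]

theorem expectation_mono {D : PMF α} {g h : α → ℝ} (hgh : ∀ a ∈ D.support, g a ≤ h a) :
    expectation D g ≤ expectation D h := by
  simp only [expectation_apply]
  refine Finset.sum_le_sum fun a _ => ?_
  by_cases ha : a ∈ D.support
  · exact mul_le_mul_of_nonneg_left (hgh a ha) ENNReal.toReal_nonneg
  · simp [(D.apply_eq_zero_iff a).2 ha]

theorem expectation_const (D : PMF α) (c : ℝ) : expectation D (fun _ => c) = c := by
  have htotal : ∑ a, (D a).toReal = 1 := by
    rw [← ENNReal.toReal_sum fun a _ => D.apply_ne_top a, ← tsum_fintype (L := .unconditional _),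
      D.tsum_coe, ENNReal.toReal_one]
  rw [expectation_apply, ← Finset.sum_mul, htotal, one_mul]

theorem expectation_pure (a : α) (g : α → ℝ) : expectation (PMF.pure a) g = g a := by
  classical
  simp [expectation_apply, PMF.pure_apply, apply_ite ENNReal.toReal]

theorem expectation_bind {β : Type*} [Fintype β] (D : PMF α) (π : α → PMF β) (g : β → ℝ) :
    expectation (D.bind π) g = expectation D fun a => expectation (π a) g := by
  have htoReal (b : β) : (D.bind π b).toReal = ∑ a, (D a).toReal * (π a b).toReal := by
    rw [PMF.bind_apply, tsum_fintype, ENNReal.toReal_sum fun a _ =>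
      ENNReal.mul_ne_top (D.apply_ne_top a) ((π a).apply_ne_top b)]
    simp only [ENNReal.toReal_mul]
  simp only [expectation_apply, htoReal, Finset.sum_mul, Finset.mul_sum, mul_assoc]
  exact Finset.sum_comm

end Expectation

section Marginals

variable {U : Type*} [Fintype U] [DecidableEq U]

theorem setProb_eq_expectation (D : PMF (Finset U)) (p : Finset U → Prop) [DecidablePred p] :
    setProb D p = expectation D fun S => if p S then 1 else 0 := by
  simp [setProb, expectation_apply, Finset.sum_filter]

theorem marginals_pure (T : Finset U) :
    marginals (PMF.pure T) = (T : Set U).indicator 1 := by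
  ext i
  simp [marginals, setProb_eq_expectation, expectation_pure, Set.indicator_apply]

theorem marginals_bind {α : Type*} [Fintype α] (D : PMF α) (π : α → PMF (Finset U)) :
    marginals (D.bind π) = ∑ a, (D a).toReal • marginals (π a) := by
  ext i
  simp [marginals, setProb_eq_expectation, expectation_bind, expectation_apply D]

theorem sum_mul_marginals (D : PMF (Finset U)) (w : U → ℝ) :
    ∑ i, w i * marginals D i = expectation D fun S => ∑ i ∈ S, w i := by
  simp only [marginals, setProb, expectation_apply, Finset.sum_filter, Finset.mul_sum]
  rw [Finset.sum_comm]
  refine Finset.sum_congr rfl fun S _ => ?_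
  simp [Finset.sum_ite_mem, mul_comm]

theorem exists_pmf_of_mem_matroidPolytope {M : Matroid U} {x : U → ℝ}
    (hx : x ∈ matroidPolytope M) :
    ∃ P : PMF (Finset U), (∀ I ∈ P.support, M.Indep (I : Set U)) ∧ marginals P = x := by
  obtain ⟨ι, _, c, v, hc0, hc1, hv, rfl⟩ := mem_convexHull_iff_exists_fintype.1 hx
  have hI (j : ι) : ∃ I : Finset U, M.Indep (I : Set U) ∧ v j = (I : Set U).indicator 1 := by
    obtain ⟨I, hI, hvI⟩ := hv j
    lift I to Finset U using I.toFinite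
    exact ⟨I, hI, hvI⟩
  choose I hI hvI using hI
  have hsum : ∑ j, ENNReal.ofReal (c j) = 1 := by
    rw [← ENNReal.ofReal_sum_of_nonneg fun j _ => hc0 j, hc1, ENNReal.ofReal_one]
  refine ⟨(PMF.ofFintype _ hsum).bind fun j => PMF.pure (I j), fun T hT => ?_, ?_⟩
  · obtain ⟨j, -, hTj⟩ := (PMF.mem_support_bind_iff _ _ _).1 hT
    rw [(PMF.mem_support_pure_iff _ _).1 hTj]
    exact hI j
  · simp only [marginals_bind, marginals_pure, PMF.ofFintype_apply, hvI,
      ENNReal.toReal_ofReal (hc0 _)]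

end Marginals

section Submodular

/-- Submodularity of a function on a lattice; for set functions, the join and the meet are the
union and the intersection. -/
def IsSubmodular {α β : Type*} [Lattice α] [Add β] [LE β] (f : α → β) : Prop :=
  ∀ a b, f (a ⊔ b) + f (a ⊓ b) ≤ f a + f b

variable {U : Type*} [DecidableEq U]

/-- The discrete derivative of a set function in the direction `i`; it vanishes at the sets that
contain `i`. -/
def marginalGain (f : Finset U → ℝ) (i : U) (S : Finset U) : ℝ :=
  f (insert i S) - f S

theorem IsSubmodular.antitone_marginalGain {f : Finset U → ℝ} (hf : IsSubmodular f)
    (hmono : Monotone f) (i : U) : Antitone (marginalGain f i) := by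
  intro S T hST
  have hunion : insert i S ∪ T = insert i T := by
    rw [Finset.insert_union, Finset.union_eq_right.2 hST]
  have hinter : S ⊆ insert i S ∩ T := Finset.subset_inter (Finset.subset_insert i S) hST
  have hsub : f (insert i S ∪ T) + f (insert i S ∩ T) ≤ f (insert i S) + f T :=
    hf (insert i S) T
  rw [hunion] at hsub
  unfold marginalGain
  linarith [hmono hinter]

theorem le_add_sum_marginalGain {f : Finset U → ℝ} (hmono : Monotone f)
    (hgain : ∀ i, Antitone (marginalGain f i)) (T I : Finset U) :
    f I ≤ f T + ∑ i ∈ I, marginalGain f i T := by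
  suffices h : f (T ∪ I) ≤ f T + ∑ i ∈ I, marginalGain f i T from
    (hmono Finset.subset_union_right).trans h
  induction I using Finset.induction_on with
  | empty => simp
  | insert a I ha ih =>
    have hgain_a : marginalGain f a (T ∪ I) ≤ marginalGain f a T :=
      hgain a Finset.subset_union_left
    rw [Finset.sum_insert ha, Finset.union_insert]
    rw [marginalGain] at hgain_a
    linarith

end Submodular

section WeightedRank

variable {U : Type*} (M : Matroid U)

/-- The rank of a finite set in a matroid, as a natural number rather than an extended one, so that
it can be scaled by real weights. -/
noncomputable def finsetRank (S : Finset U) : ℕ :=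
  (M.eRk (S : Set U)).toNat

theorem coe_finsetRank (S : Finset U) : (finsetRank M S : ℕ∞) = M.eRk (S : Set U) :=
  ENat.natCast_toNat ((M.eRk_le_encard _).trans_lt S.finite_toSet.encard_lt_top).ne

theorem isSubmodular_finsetRank [DecidableEq U] : IsSubmodular (finsetRank M) := by
  intro S T
  have h := M.eRk_inter_add_eRk_union_le (S : Set U) (T : Set U)
  rw [← Finset.coe_inter, ← Finset.coe_union, add_comm] at h
  simp only [← coe_finsetRank] at h
  exact_mod_cast h

variable {M} in
theorem card_le_finsetRank {I S : Finset U} (hI : M.Indep (I : Set U)) (hIS : I ⊆ S) :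
    I.card ≤ finsetRank M S := by
  have h := hI.encard_le_eRk_of_subset (Finset.coe_subset.2 hIS)
  rw [Set.encard_coe_eq_coe_finsetCard, ← coe_finsetRank] at h
  exact_mod_cast h

variable {M} in
theorem exists_indep_superset_card_eq_finsetRank {T S : Finset U} (hT : M.Indep (T : Set U))
    (hTS : T ⊆ S) :
    ∃ B, T ⊆ B ∧ B ⊆ S ∧ M.Indep (B : Set U) ∧ B.card = finsetRank M S := by
  obtain ⟨B, hB, hTB⟩ := hT.subset_isBasis'_of_subset (Finset.coe_subset.2 hTS)
  lift B to Finset U using S.finite_toSet.subset hB.subset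
  refine ⟨B, Finset.coe_subset.1 hTB, Finset.coe_subset.1 hB.subset, hB.indep, ?_⟩
  have h := hB.encard_eq_eRk
  rw [Set.encard_coe_eq_coe_finsetCard, ← coe_finsetRank] at h
  exact_mod_cast h

open Classical in
/-- The weighted rank function of a matroid: the largest weight of an independent subset. Weights
of either sign are allowed; elements of nonpositive weight have no effect. -/
noncomputable def weightedRank (w : U → ℝ) (S : Finset U) : ℝ :=
  (S.powerset.filter fun I : Finset U => M.Indep (I : Set U)).sup' ⟨∅, by simp⟩
    fun I => ∑ i ∈ I, w i

variable {w : U → ℝ} {S I : Finset U}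

variable {M} in
theorem sum_le_weightedRank (hI : M.Indep (I : Set U)) (hIS : I ⊆ S) :
    ∑ i ∈ I, w i ≤ weightedRank M w S :=
  Finset.le_sup' (fun I => ∑ i ∈ I, w i) (by simp [hI, hIS])

theorem exists_indep_sum_eq_weightedRank (w : U → ℝ) (S : Finset U) :
    ∃ I ⊆ S, M.Indep (I : Set U) ∧ ∑ i ∈ I, w i = weightedRank M w S := by
  classical
  obtain ⟨I, hI, hmax⟩ := Finset.exists_mem_eq_sup' (s := S.powerset.filter
    fun I : Finset U => M.Indep (I : Set U)) ⟨∅, by simp⟩ fun I => ∑ i ∈ I, w i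
  simp only [Finset.mem_filter, Finset.mem_powerset] at hI
  exact ⟨I, hI.1, hI.2, by rw [weightedRank, ← hmax]⟩

theorem weightedRank_nonneg (w : U → ℝ) (S : Finset U) : 0 ≤ weightedRank M w S := by
  simpa using sum_le_weightedRank (M := M) (w := w) (I := ∅) (by simp) S.empty_subset

theorem weightedRank_mono (w : U → ℝ) : Monotone (weightedRank M w) := by
  intro S T hST
  obtain ⟨I, hIS, hI, hsum⟩ := exists_indep_sum_eq_weightedRank M w S
  exact hsum ▸ sum_le_weightedRank hI (hIS.trans hST)

theorem weightedRank_eq_zero (hw : ∀ i ∈ S, w i ≤ 0) : weightedRank M w S = 0 := by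
  refine le_antisymm ?_ (weightedRank_nonneg M w S)
  obtain ⟨I, hIS, -, hsum⟩ := exists_indep_sum_eq_weightedRank M w S
  exact hsum ▸ Finset.sum_nonpos fun i hi => hw i (hIS hi)

/-- Peels the bottom layer, of height `c`, off the positive weights. -/
theorem weightedRank_eq_add_mul_finsetRank {c : ℝ} (hc : 0 ≤ c)
    (hcw : ∀ i ∈ S, 0 < w i → c ≤ w i) :
    weightedRank M w S = weightedRank M (fun i => max (w i - c) 0) S +
      c * finsetRank M (S.filter fun i => 0 < w i) := by
  apply le_antisymm
  · obtain ⟨I, hIS, hI, hsum⟩ := exists_indep_sum_eq_weightedRank M w S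
    have hpos : M.Indep ((I.filter fun i => 0 < w i : Finset U) : Set U) :=
      hI.subset (Finset.coe_subset.2 (I.filter_subset _))
    calc weightedRank M w S = ∑ i ∈ I, w i := hsum.symm
      _ ≤ ∑ i ∈ I, (max (w i - c) 0 + if 0 < w i then c else 0) := by
        refine Finset.sum_le_sum fun i _ => ?_
        split_ifs with hi
        · linarith [le_max_left (w i - c) 0]
        · linarith [le_max_right (w i - c) 0]
      _ = ∑ i ∈ I, max (w i - c) 0 + c * (I.filter fun i => 0 < w i).card := by
        rw [Finset.sum_add_distrib, ← Finset.sum_filter, Finset.sum_const, nsmul_eq_mul,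
          mul_comm c]
      _ ≤ _ := by
        gcongr
        · exact sum_le_weightedRank hI hIS
        · exact card_le_finsetRank hpos (Finset.filter_subset_filter _ hIS)
  · obtain ⟨T, hTS, hT, hsum⟩ :=
      exists_indep_sum_eq_weightedRank M (fun i => max (w i - c) 0) S
    obtain ⟨B, hTB, hBS, hB, hcard⟩ := exists_indep_superset_card_eq_finsetRank
      (hT.subset (Finset.coe_subset.2 (T.filter_subset fun i => 0 < w i)))
      (Finset.filter_subset_filter _ hTS)
    have hzero (i : U) (hi : ¬ 0 < w i) : max (w i - c) 0 = 0 := max_eq_right (by linarith)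
    have hmem (i : U) (hi : i ∈ B) : i ∈ S ∧ 0 < w i := by simpa using hBS hi
    calc weightedRank M (fun i => max (w i - c) 0) S +
          c * finsetRank M (S.filter fun i => 0 < w i)
        = ∑ i ∈ T.filter fun i => 0 < w i, max (w i - c) 0 + c * B.card := by
          rw [← hsum, hcard, Finset.sum_filter_of_ne fun i _ => not_imp_comm.1 (hzero i)]
      _ ≤ ∑ i ∈ B, max (w i - c) 0 + c * B.card := by gcongr
      _ = ∑ i ∈ B, (w i - c) + c * B.card := by
          congr 1
          refine Finset.sum_congr rfl fun i hi => max_eq_left ?_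
          linarith [hcw i (hmem i hi).1 (hmem i hi).2]
      _ = ∑ i ∈ B, w i := by
          rw [Finset.sum_sub_distrib, Finset.sum_const, nsmul_eq_mul]; ring
      _ ≤ weightedRank M w S := sum_le_weightedRank hB fun i hi => (hmem i hi).1

theorem isSubmodular_weightedRank [DecidableEq U] (w : U → ℝ) :
    IsSubmodular (weightedRank M w) := by
  intro S T
  induction hn : ((S ∪ T).filter fun i => 0 < w i).card using Nat.strong_induction_on
    generalizing w with
  | _ n ih =>
  set A := (S ∪ T).filter fun i => 0 < w i
  rcases A.eq_empty_or_nonempty with hempty | hnonempty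
  · have hw (i : U) (hi : i ∈ S ∪ T) : w i ≤ 0 :=
      not_lt.1 (Finset.filter_eq_empty_iff.1 hempty hi)
    have hzero {Q : Finset U} (hQ : Q ⊆ S ∪ T) : weightedRank M w Q = 0 :=
      weightedRank_eq_zero M fun i hi => hw i (hQ hi)
    simp [hzero, Finset.inter_subset_left.trans Finset.subset_union_left]
  obtain ⟨k, hkA, hmin⟩ := A.exists_min_image w hnonempty
  have hk : 0 < w k := (Finset.mem_filter.1 hkA).2
  have hfewer : ((S ∪ T).filter fun i => 0 < max (w i - w k) 0).card < n := by
    rw [← hn]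
    refine Finset.card_lt_card ((Finset.ssubset_iff_of_subset ?_).2 ⟨k, hkA, by simp⟩)
    refine Finset.monotone_filter_right _ fun i _ hi => ?_
    rcases lt_max_iff.1 hi with h | h <;> linarith
  have hlayer {Q : Finset U} (hQ : Q ⊆ S ∪ T) :=
    weightedRank_eq_add_mul_finsetRank (S := Q) M hk.le fun i hi hwi =>
      hmin i (Finset.mem_filter.2 ⟨hQ hi, hwi⟩)
  have hrank := isSubmodular_finsetRank M (S.filter fun i => 0 < w i) (T.filter fun i => 0 < w i)
  have hres := ih _ hfewer (fun i => max (w i - w k) 0) rfl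
  simp only [Finset.sup_eq_union, Finset.inf_eq_inter, ← Finset.filter_union,
    ← Finset.filter_inter_distrib] at hrank hres ⊢
  rw [hlayer Finset.Subset.rfl, hlayer (Finset.inter_subset_left.trans Finset.subset_union_left),
    hlayer Finset.subset_union_left, hlayer Finset.subset_union_right]
  have hrank' := mul_le_mul_of_nonneg_left (Nat.cast_le (α := ℝ).2 hrank) hk.le
  push_cast at hrank'
  linarith

end WeightedRank

section Thinning

variable {U : Type*} [DecidableEq U]

/-- The expectation of a real function of the random subset of `S` that keeps each element
independently with probability `t`, as a linear functional of that function. It is a polynomial in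
`t`, considered for all real `t` so that its derivatives at `0` and `1` are two-sided. -/
noncomputable def thinning (t : ℝ) (S : Finset U) : (Finset U → ℝ) →ₗ[ℝ] ℝ :=
  ∑ T ∈ S.powerset, (t ^ T.card * (1 - t) ^ (S \ T).card) • LinearMap.proj T

theorem thinning_apply (t : ℝ) (S : Finset U) (g : Finset U → ℝ) :
    thinning t S g = ∑ T ∈ S.powerset, t ^ T.card * (1 - t) ^ (S \ T).card * g T := by
  simp [thinning]

theorem thinning_empty (t : ℝ) (g : Finset U → ℝ) : thinning t ∅ g = g ∅ := by
  simp [thinning_apply]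

theorem thinning_insert {a : U} {S : Finset U} (ha : a ∉ S) (t : ℝ) (g : Finset U → ℝ) :
    thinning t (insert a S) g =
      (1 - t) * thinning t S g + t * thinning t S fun T => g (insert a T) := by
  simp only [thinning_apply, Finset.sum_powerset_insert ha, Finset.mul_sum]
  congr 1 <;> refine Finset.sum_congr rfl fun T hT => ?_
  · have haT : a ∉ T := fun h => ha (Finset.mem_powerset.1 hT h)
    rw [Finset.insert_sdiff_of_notMem S haT, Finset.card_insert_of_notMem (by simp [ha])]
    ring
  · have haT : a ∉ T := fun h => ha (Finset.mem_powerset.1 hT h)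
    rw [Finset.insert_sdiff_insert, Finset.sdiff_insert_of_notMem ha,
      Finset.card_insert_of_notMem haT]
    ring

theorem thinning_const (t c : ℝ) (S : Finset U) : thinning t S (fun _ => c) = c := by
  induction S using Finset.induction_on with
  | empty => rw [thinning_empty]
  | insert a S ha ih => rw [thinning_insert ha, ih]; ring

theorem thinning_zero (S : Finset U) (g : Finset U → ℝ) : thinning 0 S g = g ∅ := by
  induction S using Finset.induction_on with
  | empty => rw [thinning_empty]
  | insert a S ha ih => rw [thinning_insert ha, ih]; ring

theorem thinning_one (S : Finset U) (g : Finset U → ℝ) : thinning 1 S g = g S := by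
  induction S using Finset.induction_on generalizing g with
  | empty => rw [thinning_empty]
  | insert a S ha ih => rw [thinning_insert ha, ih fun T => g (insert a T)]; ring

theorem thinning_mono {t : ℝ} (ht : t ∈ Set.Icc (0 : ℝ) 1) (S : Finset U) :
    Monotone (thinning t S) := by
  intro g h hgh
  simp only [thinning_apply]
  have h1t : 0 ≤ 1 - t := sub_nonneg.2 ht.2
  exact Finset.sum_le_sum fun T _ => mul_le_mul_of_nonneg_left (hgh T)
    (mul_nonneg (pow_nonneg ht.1 _) (pow_nonneg h1t _))

theorem antitone_thinning {t : ℝ} (ht : t ∈ Set.Icc (0 : ℝ) 1) {g : Finset U → ℝ}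
    (hg : Antitone g) : Antitone fun S => thinning t S g := by
  refine Finset.antitone_iff_forall_insert_le.2 fun S a ha => ?_
  have hle : thinning t S (fun T => g (insert a T)) ≤ thinning t S g :=
    thinning_mono ht S fun T => hg (Finset.subset_insert a T)
  rw [thinning_insert ha]
  linarith [mul_le_mul_of_nonneg_left hle ht.1]

/-- Russo's formula. -/
theorem hasDerivAt_thinning (S : Finset U) (g : Finset U → ℝ) (t : ℝ) :
    HasDerivAt (fun t => thinning t S g)
      (∑ i ∈ S, thinning t (S \ {i}) (marginalGain g i)) t := by
  induction S using Finset.induction_on generalizing g with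
  | empty => simpa only [thinning_empty, Finset.sum_empty] using hasDerivAt_const t (g ∅)
  | insert a S ha ih =>
    simp only [thinning_insert ha]
    refine ((((hasDerivAt_id t).const_sub 1).mul (ih g)).add
      ((hasDerivAt_id t).mul (ih fun T => g (insert a T)))).congr_deriv ?_
    have hnew : thinning t S (marginalGain g a) =
        thinning t S (fun T => g (insert a T)) - thinning t S g :=
      map_sub (thinning t S) (fun T => g (insert a T)) g
    have hcomm (i : U) : (fun T => marginalGain g i (insert a T)) =
        marginalGain (fun T => g (insert a T)) i := by
      ext T
      simp only [marginalGain, Finset.insert_comm i a]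
    have hold (i : U) (hi : i ∈ S) : thinning t (insert a S \ {i}) (marginalGain g i) =
        (1 - t) * thinning t (S \ {i}) (marginalGain g i) +
          t * thinning t (S \ {i}) (marginalGain (fun T => g (insert a T)) i) := by
      rw [Finset.insert_sdiff_of_notMem S (by grind), thinning_insert (by simp [ha]), hcomm]
    rw [Finset.sum_insert ha, Finset.sum_congr rfl hold, Finset.sum_add_distrib,
      ← Finset.mul_sum, ← Finset.mul_sum, Finset.sdiff_singleton_eq_erase a,
      Finset.erase_insert ha, hnew]
    simp only [id_eq]
    ring

end Thinning

section CorrelationGap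

variable {U : Type*} [Fintype U] [DecidableEq U] {D P : PMF (Finset U)} {f : Finset U → ℝ}

theorem condExpectation_eq_expectation_div (D : PMF (Finset U)) (p : Finset U → Prop)
    [DecidablePred p] (g : Finset U → ℝ) :
    condExpectation D p g = expectation D (fun S => if p S then g S else 0) / setProb D p := by
  simp [condExpectation, expectation_apply, Finset.sum_filter]

theorem setProb_nonneg (D : PMF (Finset U)) (p : Finset U → Prop) [DecidablePred p] :
    0 ≤ setProb D p :=
  Finset.sum_nonneg fun _ _ => ENNReal.toReal_nonneg

theorem setProb_add_setProb_not (D : PMF (Finset U)) (p : Finset U → Prop) [DecidablePred p] :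
    setProb D p + setProb D (fun S => ¬ p S) = 1 := by
  simp only [setProb_eq_expectation, ← map_add]
  refine Eq.trans (congrArg _ ?_) (expectation_const D 1)
  ext S
  by_cases hS : p S <;> simp [hS]

theorem expectation_ite_eq_zero {p : Finset U → Prop} [DecidablePred p] (h : setProb D p = 0)
    (g : Finset U → ℝ) : expectation D (fun S => if p S then g S else 0) = 0 := by
  rw [expectation_apply]
  refine Finset.sum_eq_zero fun S _ => ?_
  split_ifs with hS
  · rw [(Finset.sum_eq_zero_iff_of_nonneg fun _ _ => ENNReal.toReal_nonneg).1 h S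
      (by simpa using hS), zero_mul]
  · exact mul_zero _

theorem IsWNR.marginals_mul_expectation_le (hD : IsWNR D) (i : U) {h : Finset U → ℝ}
    (hh : Antitone h) :
    marginals D i * expectation D (fun S => h (S \ {i})) ≤
      expectation D fun S => if i ∈ S then h (S \ {i}) else 0 := by
  have hsplit : expectation D (fun S => h (S \ {i})) =
      expectation D (fun S => if i ∈ S then h (S \ {i}) else 0) +
        expectation D fun S => if i ∉ S then h (S \ {i}) else 0 := by
    rw [← map_add]
    congr 1 with S
    by_cases hS : i ∈ S <;> simp [hS]
  have htotal := setProb_add_setProb_not D fun S => i ∈ S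
  rw [marginals, hsplit]
  rcases (setProb_nonneg D fun S => i ∈ S).eq_or_lt with hmem | hmem
  · rw [← hmem, zero_mul, expectation_ite_eq_zero hmem.symm fun S => h (S \ {i})]
  rcases (setProb_nonneg D fun S => i ∉ S).eq_or_lt with hnotMem | hnotMem
  · rw [expectation_ite_eq_zero hnotMem.symm fun S => h (S \ {i})]
    rw [← hnotMem, add_zero] at htotal
    rw [htotal, one_mul, add_zero]
  have hcond := hD i hmem hnotMem (-h) hh.neg
  rw [condExpectation_eq_expectation_div, condExpectation_eq_expectation_div,
    div_le_div_iff₀ hmem hnotMem] at hcond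
  have hneg (p : Finset U → Prop) [DecidablePred p] :
      expectation D (fun S => if p S then (-h) (S \ {i}) else 0) =
        -expectation D fun S => if p S then h (S \ {i}) else 0 := by
    rw [← map_neg]
    congr 1 with S
    by_cases hS : p S <;> simp [hS]
  rw [hneg, hneg, eq_sub_of_add_eq' htotal] at hcond
  linarith

theorem IsWNR.sum_marginals_mul_expectation_le (hD : IsWNR D) {h : U → Finset U → ℝ}
    (hh : ∀ i, Antitone (h i)) :
    ∑ i, marginals D i * expectation D (h i) ≤
      expectation D fun S => ∑ i ∈ S, h i (S \ {i}) := by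
  calc ∑ i, marginals D i * expectation D (h i)
      ≤ ∑ i, marginals D i * expectation D fun S => h i (S \ {i}) := by
        refine Finset.sum_le_sum fun i _ => mul_le_mul_of_nonneg_left ?_ (setProb_nonneg D _)
        exact expectation_mono fun S _ => hh i Finset.sdiff_subset
    _ ≤ ∑ i, expectation D fun S => if i ∈ S then h i (S \ {i}) else 0 :=
        Finset.sum_le_sum fun i _ => hD.marginals_mul_expectation_le i (hh i)
    _ = expectation D fun S => ∑ i ∈ S, h i (S \ {i}) := by
        rw [← map_sum]
        congr 1 with S
        simp [Finset.sum_apply]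

theorem expectation_le_add_sum_marginals_mul (P : PMF (Finset U)) (hmono : Monotone f)
    (hgain : ∀ i, Antitone (marginalGain f i)) (T : Finset U) :
    expectation P f ≤ f T + ∑ i, marginals P i * marginalGain f i T := by
  calc expectation P f
      ≤ expectation P ((fun _ => f T) + fun I => ∑ i ∈ I, marginalGain f i T) :=
        expectation_mono fun I _ => le_add_sum_marginalGain hmono hgain T I
    _ = f T + ∑ i, marginals P i * marginalGain f i T := by
        rw [map_add, expectation_const, ← sum_mul_marginals]
        simp only [mul_comm]

theorem expectation_le_add_sum_marginals_mul_thinning (D P : PMF (Finset U))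
    (hmono : Monotone f) (hgain : ∀ i, Antitone (marginalGain f i)) {t : ℝ}
    (ht : t ∈ Set.Icc (0 : ℝ) 1) :
    expectation P f ≤ expectation D (fun S => thinning t S f) +
      ∑ i, marginals P i * expectation D fun S => thinning t S (marginalGain f i) := by
  calc expectation P f
      = expectation D fun S => thinning t S fun _ => expectation P f := by
        simp only [thinning_const, expectation_const]
    _ ≤ expectation D fun S => thinning t S (f + ∑ i, marginals P i • marginalGain f i) := by
        refine expectation_mono fun S _ => thinning_mono ht S fun T => ?_
        simpa using expectation_le_add_sum_marginals_mul P hmono hgain T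
    _ = expectation D ((fun S => thinning t S f) +
          ∑ i, marginals P i • fun S => thinning t S (marginalGain f i)) := by
        congr 1 with S
        simp
    _ = _ := by simp only [map_add, map_sum, map_smul, smul_eq_mul]

theorem one_sub_exp_neg_mul_add_le_of_le_add_deriv {φ φ' : ℝ → ℝ} {c a : ℝ} (ha : 0 ≤ a)
    (hφ : ∀ t ∈ Set.Icc 0 a, HasDerivAt φ (φ' t) t)
    (hc : ∀ t ∈ Set.Icc 0 a, c ≤ φ t + φ' t) :
    (1 - Real.exp (-a)) * c + Real.exp (-a) * φ 0 ≤ φ a := by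
  have hderiv (t : ℝ) (ht : t ∈ Set.Icc 0 a) : HasDerivAt (fun t => Real.exp t * (φ t - c))
      (Real.exp t * (φ t - c) + Real.exp t * φ' t) t :=
    (Real.hasDerivAt_exp t).mul ((hφ t ht).sub_const c)
  have hmono : MonotoneOn (fun t => Real.exp t * (φ t - c)) (Set.Icc 0 a) := by
    refine monotoneOn_of_hasDerivWithinAt_nonneg (convex_Icc 0 a)
      (fun t ht => (hderiv t ht).continuousAt.continuousWithinAt)
      (fun t ht => (hderiv t (interior_subset ht)).hasDerivWithinAt) fun t ht => ?_
    rw [← mul_add]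
    exact mul_nonneg (Real.exp_pos t).le (by linarith [hc t (interior_subset ht)])
  have hends := hmono (Set.left_mem_Icc.2 ha) (Set.right_mem_Icc.2 ha) ha
  have hscaled := mul_le_mul_of_nonneg_left hends (Real.exp_pos (-a)).le
  rw [← mul_assoc, ← mul_assoc, ← Real.exp_add, ← Real.exp_add] at hscaled
  simp only [add_zero, neg_add_cancel, Real.exp_zero, one_mul] at hscaled
  linarith

theorem IsWNR.one_sub_inv_exp_mul_expectation_le (hD : IsWNR D)
    (hP : marginals P = marginals D) (hmono : Monotone f)
    (hgain : ∀ i, Antitone (marginalGain f i)) (h0 : 0 ≤ f ∅) :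
    (1 - 1 / Real.exp 1) * expectation P f ≤ expectation D f := by
  set φ : ℝ → ℝ := fun t => expectation D fun S => thinning t S f with hφ
  set φ' : ℝ → ℝ := fun t =>
    expectation D fun S => ∑ i ∈ S, thinning t (S \ {i}) (marginalGain f i) with hφ'
  have hderiv (t : ℝ) : HasDerivAt φ (φ' t) t := by
    simp only [hφ, hφ', expectation_apply]
    exact HasDerivAt.fun_sum fun S _ => (hasDerivAt_thinning S f t).const_mul _
  have hgap (t : ℝ) (ht : t ∈ Set.Icc (0 : ℝ) 1) : expectation P f ≤ φ t + φ' t := by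
    refine (expectation_le_add_sum_marginals_mul_thinning D P hmono hgain ht).trans ?_
    rw [hP]
    gcongr
    exact hD.sum_marginals_mul_expectation_le fun i => antitone_thinning ht (hgain i)
  have hφ0 : φ 0 = f ∅ := by simp only [hφ, thinning_zero, expectation_const]
  have hφ1 : φ 1 = expectation D f := by simp only [hφ, thinning_one]
  have hgronwall := one_sub_exp_neg_mul_add_le_of_le_add_deriv zero_le_one
    (fun t _ => hderiv t) hgap
  rw [hφ0, hφ1, Real.exp_neg, ← one_div] at hgronwall
  exact (le_add_of_nonneg_right (by positivity)).trans hgronwall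

end CorrelationGap

section Duality

open scoped Matroid

theorem exists_sum_smul_eq_of_forall_dual_le {ι E : Type*} [Fintype ι] [AddCommGroup E]
    [Module ℝ E] [TopologicalSpace E] [IsTopologicalAddGroup E] [ContinuousSMul ℝ E]
    [LocallyConvexSpace ℝ E] [T2Space E] {K : ι → Set E} {y : E} (c : ι → ℝ)
    (hcompact : ∀ s, IsCompact (K s)) (hconvex : ∀ s, Convex ℝ (K s))
    (hy : ∀ F : StrongDual ℝ E, ∃ v : ι → E, (∀ s, v s ∈ K s) ∧ F y ≤ ∑ s, c s * F (v s)) :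
    ∃ v : ι → E, (∀ s, v s ∈ K s) ∧ ∑ s, c s • v s = y := by
  let L : (ι → E) →L[ℝ] E := ∑ s, c s • ContinuousLinearMap.proj s
  have hL (v : ι → E) : L v = ∑ s, c s • v s := by simp [L]
  suffices h : y ∈ L '' Set.univ.pi K by
    obtain ⟨v, hv, rfl⟩ := h
    exact ⟨v, fun s => hv s (Set.mem_univ s), (hL v).symm⟩
  have hconvex_image : Convex ℝ (L '' Set.univ.pi K) :=
    (convex_pi fun s _ => hconvex s).linear_image L.toLinearMap
  have hclosed_image : IsClosed (L '' Set.univ.pi K) :=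
    ((isCompact_univ_pi hcompact).image L.continuous).isClosed
  rw [← iInter_halfSpaces_eq hconvex_image hclosed_image]
  refine Set.mem_iInter.2 fun F => ?_
  obtain ⟨v, hv, hle⟩ := hy F
  refine ⟨L v, ⟨v, fun s _ => hv s, rfl⟩, hle.trans_eq ?_⟩
  simp only [hL, map_sum, map_smul, smul_eq_mul]

theorem isCompact_matroidPolytope {U : Type*} [Finite U] (M : Matroid U) :
    IsCompact (matroidPolytope M) := by
  refine Set.Finite.isCompact_convexHull ℝ ?_
  refine (Set.finite_range fun I : Set U => I.indicator (1 : U → ℝ)).subset ?_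
  rintro _ ⟨I, -, rfl⟩
  exact ⟨I, rfl⟩

variable {U : Type*} [Fintype U]

theorem exists_mem_matroidPolytope_restrict_sum_eq_weightedRank (M : Matroid U) (w : U → ℝ)
    (S : Finset U) :
    ∃ v ∈ matroidPolytope (M ↾ (S : Set U)), ∑ i, w i * v i = weightedRank M w S := by
  obtain ⟨I, hIS, hI, hsum⟩ := exists_indep_sum_eq_weightedRank M w S
  refine ⟨(I : Set U).indicator 1, subset_convexHull ℝ _ ⟨I, ?_, rfl⟩, ?_⟩
  · exact Matroid.restrict_indep_iff.2 ⟨hI, Finset.coe_subset.2 hIS⟩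
  · classical
    simp [← hsum, Set.indicator_apply]

theorem exists_scheme_marginals_eq [DecidableEq U] {M : Matroid U} {D : PMF (Finset U)}
    {y : U → ℝ} (hy : ∀ w : U → ℝ, ∑ i, w i * y i ≤ expectation D (weightedRank M w)) :
    ∃ π : Finset U → PMF (Finset U),
      IsContentionResolutionScheme M π ∧ marginals (D.bind π) = y := by
  obtain ⟨v, hv, rfl⟩ : ∃ v : Finset U → U → ℝ,
      (∀ S : Finset U, v S ∈ matroidPolytope (M ↾ (S : Set U))) ∧
        ∑ S, (D S).toReal • v S = y := by
    refine exists_sum_smul_eq_of_forall_dual_le (fun S => (D S).toReal)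
      (fun S : Finset U => isCompact_matroidPolytope (M ↾ (S : Set U)))
      (fun _ => convex_convexHull ℝ _) fun F => ?_
    set w : U → ℝ := fun i => F fun j => if i = j then 1 else 0
    have hF (z : U → ℝ) : F z = ∑ i, w i * z i := by
      refine (LinearMap.pi_apply_eq_sum_univ (F : (U → ℝ) →ₗ[ℝ] ℝ) z).trans ?_
      exact Finset.sum_congr rfl fun i _ => mul_comm _ _
    choose v hv hvw using exists_mem_matroidPolytope_restrict_sum_eq_weightedRank M w
    refine ⟨v, hv, ?_⟩
    calc F y = ∑ i, w i * y i := hF y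
      _ ≤ expectation D (weightedRank M w) := hy w
      _ = ∑ S, (D S).toReal * F (v S) := by simp only [expectation_apply, hF, hvw]
  choose π hπ hπv using fun S => exists_pmf_of_mem_matroidPolytope (hv S)
  refine ⟨π, fun S T hT => ?_, by simp only [marginals_bind, hπv]⟩
  obtain ⟨hindep, hsub⟩ := Matroid.restrict_indep_iff.1 (hπ S T hT)
  exact ⟨Finset.coe_subset.1 hsub, hindep⟩

end Duality

theorem theorem1p9 {U : Type*} [Fintype U] [DecidableEq U] (M : Matroid U)
    (D : PMF (Finset U)) (hD : IsWNR D) (hx : marginals D ∈ matroidPolytope M) :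
    ∃ π : Finset U → PMF (Finset U),
      IsContentionResolutionScheme M π ∧ IsSelectable (1 - 1 / Real.exp 1) D π := by
  obtain ⟨P, hP, hPD⟩ := exists_pmf_of_mem_matroidPolytope hx
  suffices h : ∀ w : U → ℝ, ∑ i, w i * ((1 - 1 / Real.exp 1) * marginals D i) ≤
      expectation D (weightedRank M w) by
    obtain ⟨π, hπ, hmarg⟩ := exists_scheme_marginals_eq h
    exact ⟨π, hπ, fun i => (congrFun hmarg i).ge⟩
  intro w
  have hmono := weightedRank_mono M w
  have hgain := (isSubmodular_weightedRank M w).antitone_marginalGain hmono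
  calc ∑ i, w i * ((1 - 1 / Real.exp 1) * marginals D i)
      = (1 - 1 / Real.exp 1) * expectation P fun I => ∑ i ∈ I, w i := by
        rw [← sum_mul_marginals, hPD, Finset.mul_sum]
        exact Finset.sum_congr rfl fun i _ => mul_left_comm _ _ _
    _ ≤ (1 - 1 / Real.exp 1) * expectation P (weightedRank M w) := by
        refine mul_le_mul_of_nonneg_left ?_ (by simp [inv_le_one_of_one_le₀])
        exact expectation_mono fun I hI => sum_le_weightedRank (hP I hI) Finset.Subset.rfl
    _ ≤ expectation D (weightedRank M w) :=
        hD.one_sub_inv_exp_mul_expectation_le hPD hmono hgain (weightedRank_nonneg M w ∅)
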